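/- Lemma 3. Let $f$ be a smooth $\mathbb{R}^m$-valued map on an open ball $\mathcal P$ about a state $\bar V\in\mathbb{R}^m$. Suppose that $f$ is hyperbolic with constant multiplicities on $\mathcal P$: for every $V\in\mathcal P$ the Jacobian $f_V(V)$ has exactly the distinct eigenvalues $\lambda^1(V)<\dots<\lambda^n(V)$, all real and semisimple, and $p_\beta=\dim R^\beta(V)$ does not depend on $V$, where $R^\beta(V)=\ker(f_V(V)-\lambda^\beta(V)I)$. Let $\hat A(V^-,V^+)$ be an averaged matrix for $f$, that is, a matrix that is smooth in $(V^-,V^+)\in\mathcal P\times\mathcal P$ and diagonalizable with real eigenvalues, with $\hat A(V,V)=f_V(V)$ and $\hat A(V^-,V^+)(V^+-V^-)=f(V^+)-f(V^-)$. Fix $\alpha\in\{1,\dots,n\}$ and let $W^\alpha$ be a smooth parametrization of the integral manifolds of $R^\alpha$ (the "contact manifolds"): $(V^-,s)\mapsto W^\alpha(V^-,s)\in\mathcal P$ is smooth on an open subset of $\mathcal P\times\mathbb{R}^{p_\alpha}$ that contains $\mathcal P\times\{0\}$, with $W^\alpha(V^-,0)=V^-$ and $\operatorname{Span}\{W^\alpha_{s^i}(V^-,s)\}_{i=1}^{p_\alpha}=R^\alpha(W^\alpha(V^-,s))$.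 Let $r>0$ be such that the closed discs $\{|z-\lambda^\beta(\bar V)|\le r\}$, $\beta=1,\dots,n$, are pairwise disjoint, and let $$\hat P^\alpha(V^-,V^+)=\frac1{2\pi i}\oint_{|z-\lambda^\alpha(\bar V)|=r}\bigl(zI-\hat A(V^-,V^+)\bigr)^{-1}\,dz$$ be the total projection for the $\alpha$-group of eigenvalues of $\hat A$. Then there is $\delta_0>0$ such that for every $\delta\in(0,\delta_0]$ there is an $\epsilon>0$ with $\mathcal P_\epsilon:=\{V:|V-\bar V|\le\epsilon\}\subset\mathcal P$ and the following property. For all $V^-,V\in\mathcal P_\epsilon$ and $s\in B_\delta(0)\subset\mathbb{R}^{p_\alpha}$, the point $W^\alpha(V^-,s)$ is defined and every eigenvalue of $\hat A(W^\alpha(V^-,s),V)$ lies in one of the open discs $\{|z-\lambda^\beta(\bar V)|<r\}$ (so that $\hat P^\alpha(W^\alpha(V^-,s),V)$ is well defined); and for all $V^-,V\in\mathcal P_\epsilon$ there is a unique $s=s(V^-,V)\in B_\delta(0)$ such that $$\hat P^\alpha\bigl(W^\alpha(V^-,s),V\bigr)\bigl(V-W^\alpha(V^-,s)\bigr)=0.$$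 -/

import Mathlib

open scoped ContDiff

noncomputable section

namespace SteadyFlow

/-- The state space `ℝᵐ` with its Euclidean norm. -/
abbrev State (m : ℕ) : Type := EuclideanSpace ℝ (Fin m)

/-- The eigenspace `ker (f_V(V) - μ I)` of the Jacobian of the flux `f` at the state `V`. -/
def eigSpace {m : ℕ} (f : State m → State m) (V : State m) (μ : ℝ) : Submodule ℝ (State m) :=
  LinearMap.ker ((fderiv ℝ f V - μ • ContinuousLinearMap.id ℝ (State m) :
    State m →L[ℝ] State m) : State m →ₗ[ℝ] State m)

/-- `f` is hyperbolic with constant multiplicities on the open set `Ω`: `f` is smooth there, and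
for `V ∈ Ω` the numbers `lam 0 V < ⋯ < lam (n-1) V` are the distinct eigenvalues of `f_V(V)`, all
of them real and semisimple, with multiplicities `p 0, …, p (n-1)` not depending on `V`.
(Eigenspaces to distinct eigenvalues are independent, so that the last two fields say that `ℝᵐ` is
their direct sum, and there are no other real or complex eigenvalues.) -/
structure IsHyperbolic {m n : ℕ} (f : State m → State m) (Ω : Set (State m))
    (lam : Fin n → State m → ℝ) (p : Fin n → ℕ) : Prop where
  smooth : ContDiffOn ℝ ∞ f Ω
  strictMono : ∀ V ∈ Ω, StrictMono (fun α => lam α V)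
  pos : ∀ α, 0 < p α
  finrank_eq : ∀ V ∈ Ω, ∀ α, Module.finrank ℝ (eigSpace f V (lam α V)) = p α
  sum_eq : ∑ α, p α = m

/-- `W` parametrizes, smoothly in the base point and in the parameter `s ∈ ℝᵖ`, the integral
manifolds in `Ω` of the field of eigenspaces `V ↦ ker (f_V(V) - lamα(V) I)`: the
map `s ↦ W V s` passes through `V` at `s = 0`, and at each of its points its partial derivatives
span the eigenspace at that point. It is defined for `(V, s)` in an open set `D` that contains
`Ω × {0}`. -/
structure IsCharacteristicParam {m p : ℕ} (f : State m → State m) (Ω : Set (State m))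
    (lamα : State m → ℝ) (D : Set (State m × EuclideanSpace ℝ (Fin p)))
    (W : State m → EuclideanSpace ℝ (Fin p) → State m) : Prop where
  isOpen : IsOpen D
  zero_mem : ∀ V ∈ Ω, (V, 0) ∈ D
  base_mem : ∀ V s, (V, s) ∈ D → V ∈ Ω
  map_mem : ∀ V s, (V, s) ∈ D → W V s ∈ Ω
  smooth : ContDiffOn ℝ ∞ (fun q : State m × EuclideanSpace ℝ (Fin p) => W q.1 q.2) D
  map_zero : ∀ V ∈ Ω, W V 0 = V
  span_eq : ∀ V s, (V, s) ∈ D →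
    Submodule.span ℝ (Set.range fun i : Fin p =>
      fderiv ℝ (W V) s (EuclideanSpace.single i (1 : ℝ))) = eigSpace f (W V s) (lamα (W V s))

/-- `A` is an averaged matrix for the flux `f` on `Ω`: it depends smoothly on the two states, is
diagonalizable with real eigenvalues, equals the Jacobian on the diagonal, and satisfies
`A(V⁻, V⁺) (V⁺ - V⁻) = f(V⁺) - f(V⁻)`. -/
structure IsAveragedMatrix {m : ℕ} (f : State m → State m) (Ω : Set (State m))
    (A : State m → State m → Matrix (Fin m) (Fin m) ℝ) : Prop where
  smooth : ∀ i j, ContDiffOn ℝ ∞ (fun q : State m × State m => A q.1 q.2 i j) (Ω ×ˢ Ω)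
  diagonalizable : ∀ V₁ ∈ Ω, ∀ V₂ ∈ Ω, ∃ (T : Matrix (Fin m) (Fin m) ℝ) (d : Fin m → ℝ),
    IsUnit T.det ∧ A V₁ V₂ * T = T * Matrix.diagonal d
  diag : ∀ V ∈ Ω, Matrix.toEuclideanCLM (𝕜 := ℝ) (A V V) = fderiv ℝ f V
  jump : ∀ V₁ ∈ Ω, ∀ V₂ ∈ Ω,
    Matrix.toEuclideanCLM (𝕜 := ℝ) (A V₁ V₂) (V₂ - V₁) = f V₂ - f V₁

/-- A real matrix as an operator on `ℂᵐ`. -/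
def complexOp {m : ℕ} (M : Matrix (Fin m) (Fin m) ℝ) :
    EuclideanSpace ℂ (Fin m) →L[ℂ] EuclideanSpace ℂ (Fin m) :=
  Matrix.toEuclideanCLM (𝕜 := ℂ) (M.map Complex.ofReal)

/-- A real vector as a vector in `ℂᵐ`. -/
def complexVec {m : ℕ} (v : State m) : EuclideanSpace ℂ (Fin m) :=
  WithLp.toLp 2 fun i => (v i : ℂ)

/-- The total projection `(2πi)⁻¹ ∮ (z I - M)⁻¹ dz`, over the counterclockwise circle
`|z - c| = r`, for the group of eigenvalues of `M` inside this circle. -/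
def totalProj {m : ℕ} (c r : ℝ) (M : Matrix (Fin m) (Fin m) ℝ) :
    EuclideanSpace ℂ (Fin m) →L[ℂ] EuclideanSpace ℂ (Fin m) :=
  (2 * (Real.pi : ℂ) * Complex.I)⁻¹ • ∮ z in C((c : ℂ), r), resolvent (complexOp M) z

end SteadyFlow

end

namespace SteadyFlow
-- Resolvents and contour integrals in a complex Banach algebra
section BanachAlgebra

open Filter Topology

variable {B : Type*} [NormedRing B] [NormedAlgebra ℂ B]

/-! Write x = ((V⁻, V), s) and v(x) = V - W(V⁻, s), and let Q(x) be the total projection of Â(W(V⁻,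
s), V). The equation Q(x) v(x) = 0 holds at x₀ = ((V̄, V̄), 0). Since v(x₀) = 0, the derivative
there is Q(x₀) v'(x₀): no derivative of Q enters, and Q need only be Lipschitz near x₀. In the
direction of s this derivative is -Q(x₀) W_s = -W_s, because W_s maps the parameter space
isomorphically onto R^α, which Q(x₀) fixes.

These are m equations for p_α unknowns. Composing with Q(x₀) and a left inverse of W_s gives a
square system, to which the implicit function theorem applies. Nothing is lost, since Q(x₀) is
injective on the range of any idempotent Q(x) with ‖Q(x) - Q(x₀)‖ < 1
(`exists_implicitFunction_of_projection`).

Real diagonalizability makes Q(x) the sum of the real spectral projections for the eigenvalues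
inside the circle, hence a real idempotent (`totalProj_eq_complexOp`). A resolvent bound that is
uniform off the discs (`exists_resolvent_bound`) confines the spectrum to the discs and, with the
resolvent identity, makes Q Lipschitz. -/

theorem sum_smul_mul_idempotent {R A ι : Type*} [CommRing R] [Ring A] [Algebra R A] [Fintype ι]
    {e : ι → A} (he : CompleteOrthogonalIdempotents e) (d : ι → R) (i : ι) :
    (∑ j, d j • e j) * e i = d i • e i := by
  classical
  rw [Finset.sum_mul, Finset.sum_eq_single i]
  · rw [smul_mul_assoc, (he.idem i).eq]
  · intro j _ hj
    rw [smul_mul_assoc, he.ortho hj, smul_zero]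
  · simp

theorem idempotent_mul_sum_smul {R A ι : Type*} [CommRing R] [Ring A] [Algebra R A] [Fintype ι]
    {e : ι → A} (he : CompleteOrthogonalIdempotents e) (d : ι → R) (i : ι) :
    e i * (∑ j, d j • e j) = d i • e i := by
  classical
  rw [Finset.mul_sum, Finset.sum_eq_single i]
  · rw [mul_smul_comm, (he.idem i).eq]
  · intro j _ hj
    rw [mul_smul_comm, he.ortho hj.symm, smul_zero]
  · simp

theorem algebraMap_sub_mul_idempotent {ι : Type*} [Fintype ι] {e : ι → B}
    (he : CompleteOrthogonalIdempotents e) (d : ι → ℂ) (z : ℂ) (i : ι) :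
    (algebraMap ℂ B z - ∑ j, d j • e j) * e i = (z - d i) • e i := by
  rw [sub_mul, sum_smul_mul_idempotent he, sub_smul, ← Algebra.smul_def]

theorem idempotent_eq_zero_of_mem_resolventSet {ι : Type*} [Fintype ι] {e : ι → B}
    (he : CompleteOrthogonalIdempotents e) (d : ι → ℂ) (i : ι)
    (hz : d i ∈ resolventSet ℂ (∑ j, d j • e j)) : e i = 0 := by
  have h := algebraMap_sub_mul_idempotent he d (d i) i
  rw [sub_self, zero_smul] at h
  exact (IsUnit.mul_right_eq_zero hz).1 h

/-- The partial fraction decomposition of a resolvent. -/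
theorem resolvent_eq_sum {ι : Type*} [Fintype ι] {e : ι → B}
    (he : CompleteOrthogonalIdempotents e) (d : ι → ℂ) {z : ℂ}
    (hz : z ∈ resolventSet ℂ (∑ j, d j • e j)) :
    resolvent (∑ j, d j • e j) z = ∑ i, (z - d i)⁻¹ • e i := by
  have h1 : (algebraMap ℂ B z - ∑ j, d j • e j) * ∑ i, (z - d i)⁻¹ • e i = 1 := by
    rw [Finset.mul_sum, ← he.complete]
    refine Finset.sum_congr rfl fun i _ => ?_
    rw [mul_smul_comm, algebraMap_sub_mul_idempotent he, smul_smul]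
    -- At `z = d i` the inverse has the default value 0, which is harmless because `e i = 0` there.
    by_cases h : z = d i
    · rw [idempotent_eq_zero_of_mem_resolventSet he d i (h ▸ hz), smul_zero]
    · rw [inv_mul_cancel₀ (sub_ne_zero.2 h), one_smul]
  have h2 := Ring.inverse_mul_cancel _ hz
  calc resolvent (∑ j, d j • e j) z
      = resolvent (∑ j, d j • e j) z *
        ((algebraMap ℂ B z - ∑ j, d j • e j) * ∑ i, (z - d i)⁻¹ • e i) := by rw [h1, mul_one]
    _ = ∑ i, (z - d i)⁻¹ • e i := by rw [← mul_assoc, resolvent, h2, one_mul]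

theorem mem_resolventSet_sum {ι : Type*} [Fintype ι] {e : ι → B}
    (he : CompleteOrthogonalIdempotents e) (d : ι → ℂ) {z : ℂ}
    (hz : ∀ i, e i = 0 ∨ z ≠ d i) : z ∈ resolventSet ℂ (∑ j, d j • e j) := by
  have h1 : (algebraMap ℂ B z - ∑ j, d j • e j) * ∑ i, (z - d i)⁻¹ • e i = 1 := by
    rw [Finset.mul_sum, ← he.complete]
    refine Finset.sum_congr rfl fun i _ => ?_
    rw [mul_smul_comm, algebraMap_sub_mul_idempotent he, smul_smul]
    rcases hz i with h | h
    · rw [h, smul_zero]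
    · rw [inv_mul_cancel₀ (sub_ne_zero.2 h), one_smul]
  have hc : Commute (algebraMap ℂ B z - ∑ j, d j • e j) (∑ i, (z - d i)⁻¹ • e i) := by
    have hee : ∀ i j, Commute (e i) (e j) := fun i j => by
      by_cases h : i = j
      · rw [h]
      · rw [Commute, SemiconjBy, he.ortho h, he.ortho (Ne.symm h)]
    refine Commute.sub_left (Algebra.commutes z _) ?_
    exact Commute.sum_left _ _ _ fun i _ => Commute.sum_right _ _ _ fun j _ =>
      ((hee i j).smul_left _).smul_right _
  exact ⟨⟨_, _, h1, hc.eq ▸ h1⟩, rfl⟩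

/-- Partial fractions give a bound independent of `z`, so it holds uniformly on the unbounded region
off the discs, with no compactness argument. -/
theorem norm_resolvent_sum_le {ι : Type*} [Fintype ι] {e : ι → B}
    (he : CompleteOrthogonalIdempotents e) (d : ι → ℂ) {z : ℂ} {r : ℝ} (hr : 0 < r)
    (hz : ∀ i, e i = 0 ∨ r ≤ ‖z - d i‖) :
    z ∈ resolventSet ℂ (∑ j, d j • e j) ∧
      ‖resolvent (∑ j, d j • e j) z‖ ≤ r⁻¹ * ∑ i, ‖e i‖ := by
  have hmem : z ∈ resolventSet ℂ (∑ j, d j • e j) := mem_resolventSet_sum he d fun i =>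
    (hz i).imp_right fun h h' => by
      rw [h', sub_self, norm_zero] at h
      exact hr.not_ge h
  refine ⟨hmem, ?_⟩
  rw [resolvent_eq_sum he d hmem, Finset.mul_sum]
  refine norm_sum_le_of_le _ fun i _ => ?_
  rw [norm_smul, norm_inv]
  rcases hz i with h | h
  · simp [h]
  · gcongr

theorem circleIntegral_inv_sub (c w : ℂ) {r : ℝ} (hr : 0 < r) (hw : ‖w - c‖ ≠ r) :
    (2 * (Real.pi : ℂ) * Complex.I)⁻¹ * (∮ z in C(c, r), (z - w)⁻¹) =
      if ‖w - c‖ < r then 1 else 0 := by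
  split_ifs with h
  · rw [circleIntegral.integral_sub_inv_of_mem_ball (by simpa [dist_eq_norm] using h),
      inv_mul_cancel₀ Complex.two_pi_I_ne_zero]
  · have h' : r < ‖w - c‖ := lt_of_le_of_ne (not_lt.1 h) (Ne.symm hw)
    rw [Complex.circleIntegral_eq_zero_of_differentiable_on_off_countable hr.le
      (s := ∅) Set.countable_empty, mul_zero]
    · refine ContinuousOn.inv₀ (by fun_prop) fun z hz hzw => ?_
      rw [sub_eq_zero.1 hzw, Metric.mem_closedBall, dist_eq_norm] at hz
      exact h'.not_ge hz
    · intro z hz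
      refine DifferentiableAt.inv (by fun_prop) fun hzw => ?_
      have hz' := hz.1
      rw [sub_eq_zero.1 hzw, Metric.mem_ball, dist_eq_norm] at hz'
      exact h hz'

/-- The total projection of a diagonalizable element is the sum of the spectral projections to
the eigenvalues inside the circle. -/
theorem circleIntegral_resolvent_eq_sum [CompleteSpace B] {ι : Type*} [Fintype ι]
    {e : ι → B} (he : CompleteOrthogonalIdempotents e) (d : ι → ℂ) (c : ℂ) {r : ℝ} (hr : 0 < r)
    (hz : ∀ z ∈ Metric.sphere c r, z ∈ resolventSet ℂ (∑ j, d j • e j)) :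
    (2 * (Real.pi : ℂ) * Complex.I)⁻¹ • (∮ z in C(c, r), resolvent (∑ j, d j • e j) z) =
      ∑ i, if ‖d i - c‖ < r then e i else 0 := by
  have hzero : ∀ i, ‖d i - c‖ = r → e i = 0 := fun i hi =>
    idempotent_eq_zero_of_mem_resolventSet he d i (hz _ (by simpa [dist_eq_norm] using hi))
  rw [circleIntegral.integral_congr hr.le fun z h => resolvent_eq_sum he d (hz z h),
    circleIntegral.integral_fun_sum, Finset.smul_sum]
  · refine Finset.sum_congr rfl fun i _ => ?_
    -- A pole on the circle itself carries a zero idempotent; every other term is a scalar Cauchy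
    -- integral.
    rw [circleIntegral.integral_smul_const, smul_smul]
    by_cases hi : ‖d i - c‖ = r
    · simp [hzero i hi]
    · rw [circleIntegral_inv_sub c (d i) hr hi]
      split_ifs <;> simp
  · intro i _
    by_cases hi : ‖d i - c‖ = r
    · simp only [hzero i hi, smul_zero]
      exact circleIntegrable_const 0 c r
    · refine ContinuousOn.circleIntegrable hr.le (ContinuousOn.smul ?_ continuousOn_const)
      refine ContinuousOn.inv₀ (by fun_prop) fun z hz hzw => hi ?_
      rw [sub_eq_zero.1 hzw, Metric.mem_sphere, dist_eq_norm] at hz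
      exact hz

theorem resolvent_sub_resolvent {a b : B} {z : ℂ} (ha : z ∈ resolventSet ℂ a)
    (hb : z ∈ resolventSet ℂ b) :
    resolvent a z - resolvent b z = resolvent a z * (a - b) * resolvent b z := by
  have h1 : resolvent a z * (algebraMap ℂ B z - a) = 1 := Ring.inverse_mul_cancel _ ha
  have h2 : (algebraMap ℂ B z - b) * resolvent b z = 1 := Ring.mul_inverse_cancel _ hb
  have h3 : a - b = (algebraMap ℂ B z - b) - (algebraMap ℂ B z - a) := by abel
  rw [h3, mul_sub, sub_mul, h1, one_mul, mul_assoc, h2, mul_one]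

/-- Neumann series: z - b = (z - a)(1 - R_a (b - a)), where the perturbation of 1 has norm at most
1/2. The resolvent identity then gives ‖R_b‖ ≤ C + ‖R_b‖/2. -/
theorem norm_resolvent_le_of_norm_sub_le [CompleteSpace B] {a b : B} {z : ℂ} {C : ℝ} (hC : 0 < C)
    (ha : z ∈ resolventSet ℂ a) (hCa : ‖resolvent a z‖ ≤ C) (hab : ‖b - a‖ ≤ (2 * C)⁻¹) :
    z ∈ resolventSet ℂ b ∧ ‖resolvent b z‖ ≤ 2 * C := by
  have hsmall : ‖resolvent a z * (b - a)‖ ≤ 1 / 2 :=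
    calc ‖resolvent a z * (b - a)‖ ≤ ‖resolvent a z‖ * ‖b - a‖ := norm_mul_le _ _
      _ ≤ C * (2 * C)⁻¹ := by gcongr
      _ = 1 / 2 := by field_simp
  have hfac : algebraMap ℂ B z - b
      = (algebraMap ℂ B z - a) * (1 - resolvent a z * (b - a)) := by
    have h2 : (algebraMap ℂ B z - a) * resolvent a z = 1 := Ring.mul_inverse_cancel _ ha
    rw [mul_sub, ← mul_assoc, h2]
    simp
  have hb : z ∈ resolventSet ℂ b := by
    rw [spectrum.mem_resolventSet_iff, hfac]
    exact IsUnit.mul ha (isUnit_one_sub_of_norm_lt_one (hsmall.trans_lt (by norm_num)))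
  refine ⟨hb, ?_⟩
  have hid : resolvent b z = resolvent a z + resolvent a z * (b - a) * resolvent b z := by
    rw [← neg_sub a b, mul_neg, neg_mul, ← resolvent_sub_resolvent ha hb]
    abel
  have : ‖resolvent b z‖ ≤ C + 1 / 2 * ‖resolvent b z‖ := by
    calc ‖resolvent b z‖ = ‖resolvent a z + resolvent a z * (b - a) * resolvent b z‖ := by
          rw [← hid]
      _ ≤ ‖resolvent a z‖ + ‖resolvent a z * (b - a)‖ * ‖resolvent b z‖ :=
          (norm_add_le _ _).trans (by gcongr; exact norm_mul_le _ _)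
      _ ≤ C + 1 / 2 * ‖resolvent b z‖ := by gcongr
  linarith

theorem circleIntegrable_resolvent [CompleteSpace B] {a : B} {c : ℂ} {r : ℝ} (hr : 0 ≤ r)
    (ha : ∀ z ∈ Metric.sphere c r, z ∈ resolventSet ℂ a) : CircleIntegrable (resolvent a) c r :=
  ContinuousOn.circleIntegrable hr fun z hz =>
    (spectrum.hasDerivAt_resolvent_const_left (ha z hz)).continuousAt.continuousWithinAt

/-- The resolvent identity R_a - R_b = R_a (a - b) R_b, integrated over the circle, is the source of
the Lipschitz estimate for the total projection. -/
theorem norm_circleIntegral_resolvent_sub_le [CompleteSpace B] {a b : B} {c : ℂ} {r C : ℝ}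
    (hr : 0 ≤ r)
    (ha : ∀ z ∈ Metric.sphere c r, z ∈ resolventSet ℂ a ∧ ‖resolvent a z‖ ≤ C)
    (hb : ∀ z ∈ Metric.sphere c r, z ∈ resolventSet ℂ b ∧ ‖resolvent b z‖ ≤ C) :
    ‖(2 * (Real.pi : ℂ) * Complex.I)⁻¹ • (∮ z in C(c, r), resolvent a z) -
      (2 * (Real.pi : ℂ) * Complex.I)⁻¹ • (∮ z in C(c, r), resolvent b z)‖ ≤
      r * (C * C) * ‖a - b‖ := by
  rw [← smul_sub, ← circleIntegral.integral_sub
    (circleIntegrable_resolvent hr fun z hz => (ha z hz).1)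
    (circleIntegrable_resolvent hr fun z hz => (hb z hz).1)]
  refine (circleIntegral.norm_two_pi_i_inv_smul_integral_le_of_norm_le_const hr
    (C := C * C * ‖a - b‖) fun z hz => ?_).trans_eq (by ring)
  rw [resolvent_sub_resolvent (ha z hz).1 (hb z hz).1]
  have hC : 0 ≤ C := (norm_nonneg _).trans (ha z hz).2
  calc ‖resolvent a z * (a - b) * resolvent b z‖
      ≤ ‖resolvent a z‖ * ‖a - b‖ * ‖resolvent b z‖ :=
        (norm_mul_le _ _).trans (by gcongr; exact norm_mul_le _ _)
    _ ≤ C * ‖a - b‖ * C := by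
        gcongr
        exacts [(ha z hz).2, (hb z hz).2]
    _ = C * C * ‖a - b‖ := by ring

end BanachAlgebra

/-! ### Real matrices, their complexification and their total projections -/

noncomputable section Matrices

variable {m : ℕ}

/-- Complexification of real matrices, as a ring homomorphism. -/
def complexOpHom (m : ℕ) : Matrix (Fin m) (Fin m) ℝ →+*
    (EuclideanSpace ℂ (Fin m) →L[ℂ] EuclideanSpace ℂ (Fin m)) :=
  ((Matrix.toEuclideanCLM (n := Fin m) (𝕜 := ℂ) :
    Matrix (Fin m) (Fin m) ℂ ≃⋆ₐ[ℂ] _) : Matrix (Fin m) (Fin m) ℂ →+* _).comp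
    Complex.ofRealHom.mapMatrix

theorem complexOpHom_apply (M : Matrix (Fin m) (Fin m) ℝ) : complexOpHom m M = complexOp M := rfl

theorem complexOp_smul (c : ℝ) (M : Matrix (Fin m) (Fin m) ℝ) :
    complexOp (c • M) = (c : ℂ) • complexOp M := by
  have : (c • M).map Complex.ofReal = (c : ℂ) • M.map Complex.ofReal := by
    ext i j
    simp
  rw [complexOp, this, map_smul, complexOp]

theorem complexOp_complexVec (M : Matrix (Fin m) (Fin m) ℝ) (v : State m) :
    complexOp M (complexVec v) = complexVec (Matrix.toEuclideanCLM (𝕜 := ℝ) M v) := by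
  ext i
  simp [complexOp, complexVec, Matrix.ofLp_toEuclideanCLM, Matrix.mulVec, dotProduct]

/-- The embedding of real into complex vectors, as a linear map. -/
def complexVecL (m : ℕ) : State m →L[ℝ] EuclideanSpace ℂ (Fin m) :=
  LinearMap.toContinuousLinearMap
    { toFun := complexVec
      map_add' := fun v w => by ext i; simp [complexVec]
      map_smul' := fun c v => by ext i; simp [complexVec] }

/-- The coordinatewise real part of a complex vector. -/
def reVecL (m : ℕ) : EuclideanSpace ℂ (Fin m) →L[ℝ] State m :=
  LinearMap.toContinuousLinearMap
    { toFun := fun v => WithLp.toLp 2 fun i => (v i).re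
      map_add' := fun v w => by ext i; simp
      map_smul' := fun c v => by ext i; simp }

theorem reVecL_complexVec (v : State m) : reVecL m (complexVec v) = v := by
  ext i
  simp [reVecL, complexVec]

theorem complexVec_eq_zero {v : State m} : complexVec v = 0 ↔ v = 0 := by
  constructor
  · intro h
    rw [← reVecL_complexVec v, h, map_zero]
  · rintro rfl
    exact map_zero (complexVecL m)

/-- The real part of an operator on `ℂᵐ`. -/
def reOp (P : EuclideanSpace ℂ (Fin m) →L[ℂ] EuclideanSpace ℂ (Fin m)) : State m →L[ℝ] State m :=
  reVecL m ∘L P.restrictScalars ℝ ∘L complexVecL m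

theorem reOp_complexOp (M : Matrix (Fin m) (Fin m) ℝ) :
    reOp (complexOp M) = Matrix.toEuclideanCLM (𝕜 := ℝ) M := by
  ext1 v
  change reVecL m (complexOp M (complexVec v)) = _
  rw [complexOp_complexVec, reVecL_complexVec]

theorem norm_reOp_sub_le (P Q : EuclideanSpace ℂ (Fin m) →L[ℂ] EuclideanSpace ℂ (Fin m)) :
    ‖reOp P - reOp Q‖ ≤ ‖reVecL m‖ * ‖complexVecL m‖ * ‖P - Q‖ := by
  have : reOp P - reOp Q = reVecL m ∘L (P - Q).restrictScalars ℝ ∘L complexVecL m := by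
    ext1 v
    simp [reOp]
  rw [this]
  calc _ ≤ ‖reVecL m‖ * (‖(P - Q).restrictScalars ℝ‖ * ‖complexVecL m‖) :=
        (ContinuousLinearMap.opNorm_comp_le _ _).trans
          (by gcongr; exact ContinuousLinearMap.opNorm_comp_le _ _)
    _ = _ := by rw [ContinuousLinearMap.norm_restrictScalars]; ring

/-- A diagonalizable matrix is a combination of spectral projections. -/
theorem exists_spectral_decomposition {M T : Matrix (Fin m) (Fin m) ℝ} {d : Fin m → ℝ}
    (hT : IsUnit T.det) (h : M * T = T * Matrix.diagonal d) :
    ∃ N : Fin m → Matrix (Fin m) (Fin m) ℝ,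
      CompleteOrthogonalIdempotents N ∧ M = ∑ i, d i • N i := by
  have h1 : T⁻¹ * T = 1 := Matrix.nonsing_inv_mul T hT
  have h2 : T * T⁻¹ = 1 := Matrix.mul_nonsing_inv T hT
  have hmul : ∀ X Y : Matrix (Fin m) (Fin m) ℝ,
      (T * X * T⁻¹) * (T * Y * T⁻¹) = T * (X * Y) * T⁻¹ := fun X Y => by
    calc (T * X * T⁻¹) * (T * Y * T⁻¹) = T * X * (T⁻¹ * T) * Y * T⁻¹ := by
          simp only [Matrix.mul_assoc]
      _ = T * (X * Y) * T⁻¹ := by rw [h1, Matrix.mul_one, Matrix.mul_assoc T X Y]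
  refine ⟨fun i => T * Matrix.single i i 1 * T⁻¹, ⟨⟨fun i => ?_, fun i j hij => ?_⟩, ?_⟩, ?_⟩
  · change _ * _ = _
    rw [hmul, Matrix.single_mul_single_same, mul_one]
  · change _ * _ = _
    rw [hmul, Matrix.single_mul_single_of_ne _ _ _ _ hij]
    simp
  · rw [← Finset.sum_mul, ← Finset.mul_sum, Matrix.sum_single_one, Matrix.mul_one, h2]
  · have hd : Matrix.diagonal d = ∑ i, d i • Matrix.single i i (1 : ℝ) := by
      simp [← Matrix.sum_single_eq_diagonal]
    calc M = M * T * T⁻¹ := by rw [Matrix.mul_assoc, h2, Matrix.mul_one]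
      _ = _ := by
        rw [h, hd, Finset.mul_sum, Finset.sum_mul]
        simp only [Matrix.mul_smul, Matrix.smul_mul]

theorem complexOp_sum_smul {ι : Type*} [Fintype ι] (d : ι → ℝ)
    (N : ι → Matrix (Fin m) (Fin m) ℝ) :
    complexOp (∑ i, d i • N i) = ∑ i, (d i : ℂ) • complexOp (N i) := by
  rw [← complexOpHom_apply, map_sum]
  simp only [complexOpHom_apply, complexOp_smul]

theorem totalProj_eq_complexOp {N : Fin m → Matrix (Fin m) (Fin m) ℝ}
    (hN : CompleteOrthogonalIdempotents N) (d : Fin m → ℝ) (c : ℝ) {r : ℝ} (hr : 0 < r)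
    (hz : ∀ z ∈ Metric.sphere (c : ℂ) r, z ∈ resolventSet ℂ (complexOp (∑ i, d i • N i))) :
    totalProj c r (∑ i, d i • N i) = complexOp (∑ i with |d i - c| < r, N i) := by
  have he := hN.map (complexOpHom m)
  rw [complexOp_sum_smul] at hz
  rw [totalProj, complexOp_sum_smul]
  refine (circleIntegral_resolvent_eq_sum he (fun i => (d i : ℂ)) c hr hz).trans ?_
  rw [← complexOpHom_apply, map_sum, Finset.sum_filter]
  refine Finset.sum_congr rfl fun i _ => ?_
  rw [← Complex.ofReal_sub, Complex.norm_real, Real.norm_eq_abs]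
  rfl

/-- The total projection of a real diagonalizable matrix is a real projection. -/
theorem exists_totalProj_eq_complexOp {M T : Matrix (Fin m) (Fin m) ℝ} {d : Fin m → ℝ}
    (hT : IsUnit T.det) (h : M * T = T * Matrix.diagonal d) (c : ℝ) {r : ℝ} (hr : 0 < r)
    (hz : ∀ z ∈ Metric.sphere (c : ℂ) r, z ∈ resolventSet ℂ (complexOp M)) :
    ∃ Q : Matrix (Fin m) (Fin m) ℝ, IsIdempotentElem Q ∧ totalProj c r M = complexOp Q := by
  obtain ⟨N, hN, rfl⟩ := exists_spectral_decomposition hT h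
  exact ⟨_, hN.isIdempotentElem_sum, totalProj_eq_complexOp hN d c hr hz⟩

end Matrices

/-! ### Implicit functions for an equation with a variable projection -/

section ImplicitFunction

open Filter Topology Asymptotics

variable {X E F : Type*} [NormedAddCommGroup X] [NormedSpace ℝ X]
  [NormedAddCommGroup E] [NormedSpace ℝ E] [NormedAddCommGroup F] [NormedSpace ℝ F]

/-- An operator applied to a vector that vanishes at the base point is strictly differentiable there
as soon as the operator is locally Lipschitz. -/
theorem hasStrictFDerivAt_apply_of_eq_zero {Q : X → E →L[ℝ] F} {v : X → E} {v' : X →L[ℝ] E}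
    {x₀ : X} (hv : HasStrictFDerivAt v v' x₀) (h0 : v x₀ = 0)
    (hQ : (fun q : X × X => Q q.1 - Q q.2) =O[𝓝 (x₀, x₀)] fun q => q.1 - q.2)
    (hQc : ContinuousAt Q x₀) :
    HasStrictFDerivAt (fun x => Q x (v x)) (Q x₀ ∘L v') x₀ := by
  have h1 : HasStrictFDerivAt (fun x => Q x₀ (v x)) (Q x₀ ∘L v') x₀ :=
    (Q x₀).hasStrictFDerivAt.comp x₀ hv
  refine HasStrictFDerivAt.of_isLittleO ?_
  have hv0 : Tendsto v (𝓝 x₀) (𝓝 0) := h0 ▸ hv.continuousAt.tendsto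
  have hQ0 : Tendsto (fun x => Q x - Q x₀) (𝓝 x₀) (𝓝 0) := by
    have := hQc.tendsto.sub_const (Q x₀)
    rwa [sub_self] at this
  have hfst : Tendsto (Prod.fst : X × X → X) (𝓝 (x₀, x₀)) (𝓝 x₀) := continuous_fst.tendsto _
  have hsnd : Tendsto (Prod.snd : X × X → X) (𝓝 (x₀, x₀)) (𝓝 x₀) := continuous_snd.tendsto _
  -- With Q₀ = `Q x₀`, the increment Q(x) v(x) - Q(y) v(y) splits as (Q(x) - Q₀)(v(x) - v(y)) +
  -- (Q(x) - Q(y)) v(y) + Q₀(v(x) - v(y)). The first two terms are negligible: each pairs a factor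
  -- tending to 0 with one that is O(x - y).
  have t1 : (fun q : X × X => (Q q.1 - Q x₀) (v q.1 - v q.2)) =o[𝓝 (x₀, x₀)]
      fun q => q.1 - q.2 := by
    have ha : (fun q : X × X => Q q.1 - Q x₀) =o[𝓝 (x₀, x₀)] fun _ => (1 : ℝ) :=
      (isLittleO_one_iff ℝ).2 (hQ0.comp hfst)
    have hb := ha.norm_left.mul_isBigO hv.isBigO_sub.norm_norm
    refine (IsBigO.of_bound' (Eventually.of_forall fun q => ?_)).trans_isLittleO
      (hb.trans_isBigO (IsBigO.of_bound' (Eventually.of_forall fun q => ?_)))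
    · rw [Real.norm_eq_abs, abs_of_nonneg (by positivity)]
      exact (Q q.1 - Q x₀).le_opNorm _
    · simp
  have t2 : (fun q : X × X => (Q q.1 - Q q.2) (v q.2)) =o[𝓝 (x₀, x₀)]
      fun q => q.1 - q.2 := by
    have ha : (fun q : X × X => v q.2) =o[𝓝 (x₀, x₀)] fun _ => (1 : ℝ) :=
      (isLittleO_one_iff ℝ).2 (hv0.comp hsnd)
    have hb := hQ.norm_norm.mul_isLittleO ha.norm_left
    refine (IsBigO.of_bound' (Eventually.of_forall fun q => ?_)).trans_isLittleO
      (hb.trans_isBigO (IsBigO.of_bound' (Eventually.of_forall fun q => ?_)))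
    · rw [Real.norm_eq_abs, abs_of_nonneg (by positivity)]
      exact (Q q.1 - Q q.2).le_opNorm _
    · simp
  refine ((t1.add t2).add h1.isLittleO).congr_left fun q => ?_
  simp only [sub_apply, map_sub]
  abel

/-- If an idempotent `q` is close to `q₀`, then `q₀` is injective on the range of `q`. -/
theorem apply_eq_zero_of_norm_sub_lt_one {q q₀ : E →L[ℝ] E} (hq : IsIdempotentElem q)
    (hlt : ‖q - q₀‖ < 1) {v : E} (hv : q₀ (q v) = 0) : q v = 0 := by
  have hqq : q (q v) = q v := DFunLike.congr_fun hq v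
  have h : (q - q₀) (q v) = q v := by
    rw [sub_apply, hqq, hv, sub_zero]
  by_contra hne
  have hpos : 0 < ‖q v‖ := norm_pos_iff.2 hne
  have := (q - q₀).le_opNorm (q v)
  rw [h] at this
  nlinarith

/-- Implicit function theorem for an equation `Q (v) = 0` with a variable projection `Q`, where `v`
vanishes at the base point. -/
theorem exists_implicitFunction_of_projection {Y : Type*} [NormedAddCommGroup Y] [NormedSpace ℝ Y]
    [CompleteSpace Y] [CompleteSpace F] {Q : Y × F → E →L[ℝ] E} {v : Y × F → E}
    {v' : Y × F →L[ℝ] E} {x₀ : Y × F} {L : F →L[ℝ] E} {π : E →L[ℝ] F}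
    (hπ : ∀ s, π (L s) = s) (hv : HasStrictFDerivAt v v' x₀) (h0 : v x₀ = 0)
    (hv' : ∀ s, v' (0, s) = -L s)
    (hQ : (fun q : (Y × F) × (Y × F) => Q q.1 - Q q.2) =O[𝓝 (x₀, x₀)] fun q => q.1 - q.2)
    (hid : ∀ᶠ x in 𝓝 x₀, IsIdempotentElem (Q x))
    (hrange : ∀ w, ∃ s, Q x₀ w = L s) (hL : ∀ s, Q x₀ (L s) = L s) :
    ∃ φ : Y → F, Tendsto φ (𝓝 x₀.1) (𝓝 x₀.2) ∧ ∀ᶠ x in 𝓝 x₀, Q x (v x) = 0 ↔ φ x.1 = x.2 := by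
  have hQc : ContinuousAt Q x₀ := by
    have h1 : Tendsto (fun x : Y × F => (x, x₀)) (𝓝 x₀) (𝓝 (x₀, x₀)) :=
      (by fun_prop : Continuous fun x : Y × F => (x, x₀)).tendsto x₀
    have h2 : Tendsto (fun x : Y × F => x - x₀) (𝓝 x₀) (𝓝 0) := by
      simpa using (by fun_prop : Continuous fun x : Y × F => x - x₀).tendsto x₀
    exact tendsto_sub_nhds_zero_iff.1 ((hQ.comp_tendsto h1).trans_tendsto h2)
  have hd : HasStrictFDerivAt (fun x => π (Q x₀ (Q x (v x)))) ((π ∘L Q x₀) ∘L (Q x₀ ∘L v')) x₀ :=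
    (π ∘L Q x₀).hasStrictFDerivAt.comp x₀ (hasStrictFDerivAt_apply_of_eq_zero hv h0 hQ hQc)
  -- The partial derivative in `s` is minus the identity of `F`.
  have hinv : (((π ∘L Q x₀) ∘L (Q x₀ ∘L v')) ∘L .inr ℝ Y F).IsInvertible := by
    refine ⟨ContinuousLinearEquiv.neg ℝ, ?_⟩
    ext1 s
    simp [hv', hL, hπ]
  refine ⟨hd.implicitFunctionOfProdDomain hinv, hd.tendsto_implicitFunctionOfProdDomain hinv, ?_⟩
  have hclose : ∀ᶠ x in 𝓝 x₀, ‖Q x - Q x₀‖ < 1 := by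
    filter_upwards [hQc.eventually (Metric.ball_mem_nhds (Q x₀) one_pos)] with x hx
    simpa [dist_eq_norm] using hx
  filter_upwards [hd.eventually_apply_eq_iff_implicitFunctionOfProdDomain hinv, hid, hclose]
    with x hx hidx hlt
  rw [← hx]
  simp only [h0, map_zero]
  refine ⟨fun h => by rw [h, map_zero, map_zero], fun h => ?_⟩
  -- `π` is injective on the range of `L`, which contains the range of `Q x₀`; closeness of `Q x` to
  -- `Q x₀` then removes the remaining factor `Q x₀`.
  obtain ⟨s, hs⟩ := hrange (Q x (v x))
  rw [hs, hπ] at h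
  rw [h, map_zero] at hs
  exact apply_eq_zero_of_norm_sub_lt_one hidx hlt hs

end ImplicitFunction

/-! ### Eigenspaces of the Jacobian and the characteristic parametrization -/

section Jacobian

/-- Eigenspaces to distinct eigenvalues are independent, so their direct sum embeds in `V`. -/
theorem sum_finrank_eigenspace_le {K V ι : Type*} [Field K] [AddCommGroup V] [Module K V]
    [FiniteDimensional K V] [Fintype ι] (T : Module.End K V) {μ : ι → K}
    (hμ : Function.Injective μ) :
    ∑ i, Module.finrank K (T.eigenspace (μ i)) ≤ Module.finrank K V := by
  classical
  have h := (T.eigenspaces_iSupIndep.comp hμ).dfinsupp_lsum_injective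
  have h2 := LinearMap.finrank_le_finrank_of_injective h
  have h3 := Module.finrank_directSum (R := K) fun i => T.eigenspace (μ i)
  exact h3.symm.trans_le h2

variable {m n : ℕ} {f : State m → State m} {Ω : Set (State m)} {lam : Fin n → State m → ℝ}
  {p : Fin n → ℕ}

theorem mem_eigSpace {V : State m} {μ : ℝ} {v : State m} :
    v ∈ eigSpace f V μ ↔ fderiv ℝ f V v = μ • v := by
  simp [eigSpace, sub_eq_zero]

theorem eigSpace_eq_eigenspace (V : State m) (μ : ℝ) :
    eigSpace f V μ = Module.End.eigenspace (fderiv ℝ f V : State m →ₗ[ℝ] State m) μ := by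
  ext v
  rw [mem_eigSpace, Module.End.mem_eigenspace_iff]
  rfl

theorem sum_finrank_eigSpace_le {ι : Type*} [Fintype ι] (V : State m) {μ : ι → ℝ}
    (hμ : Function.Injective μ) : ∑ i, Module.finrank ℝ (eigSpace f V (μ i)) ≤ m := by
  have h := sum_finrank_eigenspace_le (fderiv ℝ f V : State m →ₗ[ℝ] State m) hμ
  rw [finrank_euclideanSpace_fin] at h
  refine (Finset.sum_congr rfl fun i _ => ?_).trans_le h
  rw [eigSpace_eq_eigenspace]

/-- The Jacobian of a hyperbolic flux has no eigenvalues other than the `lam β V`. -/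
theorem IsHyperbolic.eigSpace_eq_bot (hf : IsHyperbolic f Ω lam p) {V : State m} (hV : V ∈ Ω)
    {μ : ℝ} (hμ : ∀ β, μ ≠ lam β V) : eigSpace f V μ = ⊥ := by
  -- Adjoin `μ` as one more eigenvalue: the eigenspaces of the `lam β V` already have total
  -- dimension `m`, leaving none for `μ`.
  have hinj : Function.Injective (fun o : Option (Fin n) => o.elim μ fun β => lam β V) := by
    rintro (_ | β) (_ | γ) h
    · rfl
    · exact (hμ γ h).elim
    · exact (hμ β h.symm).elim
    · exact congrArg some ((hf.strictMono V hV).injective h)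
  have h := sum_finrank_eigSpace_le (f := f) V hinj
  rw [Fintype.sum_option] at h
  replace h : Module.finrank ℝ (eigSpace f V μ) +
    ∑ β, Module.finrank ℝ (eigSpace f V (lam β V)) ≤ m := h
  simp only [hf.finrank_eq V hV, hf.sum_eq] at h
  exact Submodule.finrank_eq_zero.1 (by omega)

section SpectralDecomposition

variable {V : State m} {N : Fin m → Matrix (Fin m) (Fin m) ℝ} {d : Fin m → ℝ}

theorem spectralProjection_mem_eigSpace (hN : CompleteOrthogonalIdempotents N)
    (hM : Matrix.toEuclideanCLM (𝕜 := ℝ) (∑ i, d i • N i) = fderiv ℝ f V) (i : Fin m)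
    (v : State m) : Matrix.toEuclideanCLM (𝕜 := ℝ) (N i) v ∈ eigSpace f V (d i) := by
  rw [mem_eigSpace, ← hM, ← mul_apply_eq_comp, ← map_mul, sum_smul_mul_idempotent hN,
    map_smul]
  rfl

theorem IsHyperbolic.spectralProjection_eq_zero_or (hf : IsHyperbolic f Ω lam p) (hV : V ∈ Ω)
    (hN : CompleteOrthogonalIdempotents N)
    (hM : Matrix.toEuclideanCLM (𝕜 := ℝ) (∑ i, d i • N i) = fderiv ℝ f V) (i : Fin m) :
    N i = 0 ∨ ∃ β, d i = lam β V := by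
  by_cases h : ∃ β, d i = lam β V
  · exact Or.inr h
  push Not at h
  left
  apply (Matrix.toEuclideanCLM (n := Fin m) (𝕜 := ℝ)).injective
  rw [map_zero]
  ext1 v
  have := spectralProjection_mem_eigSpace hN hM i v
  rwa [hf.eigSpace_eq_bot hV h, Submodule.mem_bot] at this

theorem groupProjection_mem_eigSpace (hN : CompleteOrthogonalIdempotents N)
    (hM : Matrix.toEuclideanCLM (𝕜 := ℝ) (∑ i, d i • N i) = fderiv ℝ f V) {c r : ℝ}
    (hd : ∀ i, N i = 0 ∨ (|d i - c| < r → d i = c)) (v : State m) :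
    Matrix.toEuclideanCLM (𝕜 := ℝ) (∑ i with |d i - c| < r, N i) v ∈ eigSpace f V c := by
  rw [map_sum, sum_apply]
  refine Submodule.sum_mem _ fun i hi => ?_
  rcases hd i with h | h
  · rw [h, map_zero]
    exact Submodule.zero_mem _
  · rw [← h (Finset.mem_filter.1 hi).2]
    exact spectralProjection_mem_eigSpace hN hM i v

theorem groupProjection_apply_of_mem_eigSpace (hN : CompleteOrthogonalIdempotents N)
    (hM : Matrix.toEuclideanCLM (𝕜 := ℝ) (∑ i, d i • N i) = fderiv ℝ f V) {c r : ℝ} (hr : 0 < r)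
    {v : State m} (hv : v ∈ eigSpace f V c) :
    Matrix.toEuclideanCLM (𝕜 := ℝ) (∑ i with |d i - c| < r, N i) v = v := by
  -- Applying `N i` to the eigenvalue equation gives (d i - c) N i v = 0, and `d i ≠ c` when `d i`
  -- is outside the disc.
  have hz : ∀ i, ¬ |d i - c| < r → Matrix.toEuclideanCLM (𝕜 := ℝ) (N i) v = 0 := by
    intro i hi
    rw [mem_eigSpace, ← hM] at hv
    have h1 := congrArg (Matrix.toEuclideanCLM (𝕜 := ℝ) (N i)) hv
    rw [← mul_apply_eq_comp, ← map_mul, idempotent_mul_sum_smul hN, map_smul,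
      map_smul, smul_apply, ← sub_eq_zero, ← sub_smul, smul_eq_zero] at h1
    refine h1.resolve_left fun h0 => hi ?_
    rwa [h0, abs_zero]
  have hone : ∑ i, Matrix.toEuclideanCLM (𝕜 := ℝ) (N i) v = v := by
    rw [← sum_apply, ← map_sum, hN.complete, map_one]
    rfl
  rw [map_sum, sum_apply, Finset.sum_filter]
  refine Eq.trans (Finset.sum_congr rfl fun i _ => ?_) hone
  split_ifs with h
  · rfl
  · exact (hz i h).symm

end SpectralDecomposition

theorem contDiffAt_complexOp {X : Type*} [NormedAddCommGroup X] [NormedSpace ℝ X]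
    {M : X → Matrix (Fin m) (Fin m) ℝ} {x₀ : X} (h : ∀ i j, ContDiffAt ℝ ∞ (fun x => M x i j) x₀) :
    ContDiffAt ℝ ∞ (fun x => complexOp (M x)) x₀ := by
  have : (fun x => complexOp (M x)) =
      fun x => ∑ i, ∑ j, M x i j • complexOp (Matrix.single i j 1) := by
    ext1 x
    conv_lhs => rw [Matrix.matrix_eq_sum_single (M x), ← complexOpHom_apply, map_sum]
    refine Finset.sum_congr rfl fun i _ => ?_
    rw [map_sum]
    refine Finset.sum_congr rfl fun j _ => ?_
    have h1 : Matrix.single i j (M x i j) = M x i j • Matrix.single i j (1 : ℝ) := by simp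
    rw [h1, complexOpHom_apply, complexOp_smul]
    exact Complex.coe_smul (M x i j) (complexOp (Matrix.single i j 1))
  rw [this]
  exact ContDiffAt.sum fun i _ => ContDiffAt.sum fun j _ => (h i j).smul contDiffAt_const

section Param

variable {k : ℕ} {lamα : State m → ℝ} {D : Set (State m × EuclideanSpace ℝ (Fin k))}
  {W : State m → EuclideanSpace ℝ (Fin k) → State m}

theorem IsCharacteristicParam.range_fderiv (hW : IsCharacteristicParam f Ω lamα D W) {V : State m}
    (hV : V ∈ Ω) :
    LinearMap.range (fderiv ℝ (W V) 0 : EuclideanSpace ℝ (Fin k) →ₗ[ℝ] State m) =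
      eigSpace f V (lamα V) := by
  have h := hW.span_eq V 0 (hW.zero_mem V hV)
  rw [hW.map_zero V hV] at h
  rw [← h, LinearMap.range_eq_map, ← (EuclideanSpace.basisFun (Fin k) ℝ).toBasis.span_eq,
    Submodule.map_span, ← Set.range_comp]
  congr 2
  ext1 i
  simp

/-- Rank-nullity: the number of parameters equals the dimension of the eigenspace they span. -/
theorem IsCharacteristicParam.injective_fderiv (hW : IsCharacteristicParam f Ω lamα D W)
    {V : State m} (hV : V ∈ Ω) (hk : Module.finrank ℝ (eigSpace f V (lamα V)) = k) :
    LinearMap.ker (fderiv ℝ (W V) 0 : EuclideanSpace ℝ (Fin k) →ₗ[ℝ] State m) = ⊥ := by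
  have h := LinearMap.finrank_range_add_finrank_ker
    (fderiv ℝ (W V) 0 : EuclideanSpace ℝ (Fin k) →ₗ[ℝ] State m)
  rw [hW.range_fderiv hV, hk, finrank_euclideanSpace_fin] at h
  exact Submodule.finrank_eq_zero.1 (by omega)

theorem IsCharacteristicParam.contDiffAt (hW : IsCharacteristicParam f Ω lamα D W) {V : State m}
    (hV : V ∈ Ω) :
    ContDiffAt ℝ ∞ (fun q : State m × EuclideanSpace ℝ (Fin k) => W q.1 q.2) (V, 0) :=
  hW.smooth.contDiffAt (hW.isOpen.mem_nhds (hW.zero_mem V hV))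

/-- The jump `V - W(V⁻, s)` is strictly differentiable, with the expected derivative in `s`. -/
theorem IsCharacteristicParam.exists_hasStrictFDerivAt (hW : IsCharacteristicParam f Ω lamα D W)
    {V : State m} (hV : V ∈ Ω) :
    ∃ v' : (State m × State m) × EuclideanSpace ℝ (Fin k) →L[ℝ] State m,
      HasStrictFDerivAt (fun x : (State m × State m) × EuclideanSpace ℝ (Fin k) =>
        x.1.2 - W x.1.1 x.2) v' ((V, V), 0) ∧ ∀ s, v' (0, s) = -fderiv ℝ (W V) 0 s := by
  have h := (hW.contDiffAt hV).hasStrictFDerivAt (by simp)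
  set W' := fderiv ℝ (fun q : State m × EuclideanSpace ℝ (Fin k) => W q.1 q.2) (V, 0)
  have h1 : HasStrictFDerivAt (fun x : (State m × State m) × EuclideanSpace ℝ (Fin k) =>
      (x.1.1, x.2)) (((ContinuousLinearMap.fst ℝ _ _) ∘L (ContinuousLinearMap.fst ℝ _ _)).prod
        (ContinuousLinearMap.snd ℝ _ _)) ((V, V), 0) :=
    ContinuousLinearMap.hasStrictFDerivAt
      (((ContinuousLinearMap.fst ℝ (State m) (State m)) ∘L
        (ContinuousLinearMap.fst ℝ (State m × State m) (EuclideanSpace ℝ (Fin k)))).prod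
        (ContinuousLinearMap.snd ℝ _ _))
  have h2 : HasStrictFDerivAt (fun x : (State m × State m) × EuclideanSpace ℝ (Fin k) => x.1.2)
      ((ContinuousLinearMap.snd ℝ (State m) (State m)) ∘L
        (ContinuousLinearMap.fst ℝ (State m × State m) (EuclideanSpace ℝ (Fin k)))) ((V, V), 0) :=
    ContinuousLinearMap.hasStrictFDerivAt ((ContinuousLinearMap.snd ℝ (State m) (State m)) ∘L
        (ContinuousLinearMap.fst ℝ (State m × State m) (EuclideanSpace ℝ (Fin k))))
  have h3 := HasStrictFDerivAt.comp ((V, V), (0 : EuclideanSpace ℝ (Fin k))) h h1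
  refine ⟨_, h2.sub h3, fun s => ?_⟩
  have h4 : HasFDerivAt (W V) (W' ∘L .inr ℝ _ _) 0 :=
    h.hasFDerivAt.comp (0 : EuclideanSpace ℝ (Fin k)) (hasFDerivAt_prodMk_right V 0)
  rw [h4.fderiv]
  simp

end Param

end Jacobian

/-! ### The total projection of the averaged matrix near the base state -/

section Assembly

open Filter Topology

variable {m n : ℕ} {f : State m → State m} {Ω : Set (State m)} {lam : Fin n → State m → ℝ}
  {p : Fin n → ℕ} {A : State m → State m → Matrix (Fin m) (Fin m) ℝ}

/-- Resolvents of the averaged matrix are uniformly bounded off the discs of radius `r` about the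
eigenvalues of the Jacobian at `V`, for all matrices close to that Jacobian. -/
theorem exists_resolvent_bound (hf : IsHyperbolic f Ω lam p) (hA : IsAveragedMatrix f Ω A)
    {V : State m} (hV : V ∈ Ω) {r : ℝ} (hr : 0 < r) :
    ∃ C : ℝ, 0 < C ∧ ∀ b, ‖b - complexOp (A V V)‖ ≤ (2 * C)⁻¹ →
      ∀ z : ℂ, (∀ β, r ≤ ‖z - lam β V‖) → z ∈ resolventSet ℂ b ∧ ‖resolvent b z‖ ≤ 2 * C := by
  obtain ⟨T, d, hT, h⟩ := hA.diagonalizable V hV V hV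
  obtain ⟨N, hN, hAN⟩ := exists_spectral_decomposition hT h
  have hM := hA.diag V hV
  rw [hAN] at hM
  -- The `+ 1` makes the constant positive without asking whether some `N i` is nonzero.
  refine ⟨r⁻¹ * ∑ i, ‖complexOp (N i)‖ + 1, by positivity, fun b hb z hz => ?_⟩
  have hN' := hN.map (complexOpHom m)
  have h1 := norm_resolvent_sum_le hN' (fun i => (d i : ℂ)) hr (z := z) fun i => by
    rcases hf.spectralProjection_eq_zero_or hV hN hM i with h | ⟨β, h⟩
    · left
      rw [Function.comp_apply, h, map_zero]
    · right
      rw [h]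
      exact hz β
  have h2 : ∑ i, (d i : ℂ) • (complexOpHom m ∘ N) i = complexOp (A V V) := by
    rw [hAN, complexOp_sum_smul]
    rfl
  rw [h2] at h1
  exact norm_resolvent_le_of_norm_sub_le (by positivity) h1.1
    (h1.2.trans (le_add_of_nonneg_right zero_le_one)) hb

/-- By the triangle inequality and the gap `2 * r`, the circle about one eigenvalue stays outside
the other open discs, so the resolvent bound applies on the contour. -/
theorem le_norm_sub_of_mem_sphere {V : State m} {r : ℝ} {α : Fin n}
    (hgap : ∀ β γ : Fin n, β ≠ γ → 2 * r < |lam β V - lam γ V|) {z : ℂ}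
    (hz : z ∈ Metric.sphere (lam α V : ℂ) r) (β : Fin n) : r ≤ ‖z - lam β V‖ := by
  rw [Metric.mem_sphere, dist_eq_norm] at hz
  by_cases h : β = α
  · rw [h, hz]
  · have h1 : ‖(lam β V : ℂ) - lam α V‖ = |lam β V - lam α V| := by
      rw [← Complex.ofReal_sub, Complex.norm_real, Real.norm_eq_abs]
    have h2 := norm_sub_le_norm_sub_add_norm_sub (lam β V : ℂ) z (lam α V)
    rw [norm_sub_rev _ z] at h2
    linarith [hgap β α h]

/-- The total projection at the base state is a projection onto the eigenspace. -/
theorem reOp_totalProj_base (hf : IsHyperbolic f Ω lam p) (hA : IsAveragedMatrix f Ω A)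
    {V : State m} (hV : V ∈ Ω) {r : ℝ} (hr : 0 < r) {α : Fin n}
    (hgap : ∀ β γ : Fin n, β ≠ γ → 2 * r < |lam β V - lam γ V|)
    (hz : ∀ z ∈ Metric.sphere (lam α V : ℂ) r, z ∈ resolventSet ℂ (complexOp (A V V))) :
    (∀ w, reOp (totalProj (lam α V) r (A V V)) w ∈ eigSpace f V (lam α V)) ∧
      ∀ v ∈ eigSpace f V (lam α V), reOp (totalProj (lam α V) r (A V V)) v = v := by
  obtain ⟨T, d, hT, h⟩ := hA.diagonalizable V hV V hV
  obtain ⟨N, hN, hAN⟩ := exists_spectral_decomposition hT h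
  have hM := hA.diag V hV
  rw [hAN] at hM hz ⊢
  rw [totalProj_eq_complexOp hN d _ hr hz, reOp_complexOp]
  refine ⟨groupProjection_mem_eigSpace hN hM fun i => ?_,
    fun v hv => groupProjection_apply_of_mem_eigSpace hN hM hr hv⟩
  refine (hf.spectralProjection_eq_zero_or hV hN hM i).imp_right ?_
  rintro ⟨β, hβ⟩ hlt
  by_contra hne
  have hβα : β ≠ α := fun h => hne (h ▸ hβ)
  have := hgap β α hβα
  rw [hβ] at hlt
  linarith

theorem norm_totalProj_sub_le {c r C : ℝ} (hr : 0 ≤ r) {M M' : Matrix (Fin m) (Fin m) ℝ}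
    (h : ∀ z ∈ Metric.sphere (c : ℂ) r,
      z ∈ resolventSet ℂ (complexOp M) ∧ ‖resolvent (complexOp M) z‖ ≤ C)
    (h' : ∀ z ∈ Metric.sphere (c : ℂ) r,
      z ∈ resolventSet ℂ (complexOp M') ∧ ‖resolvent (complexOp M') z‖ ≤ C) :
    ‖totalProj c r M - totalProj c r M'‖ ≤ r * (C * C) * ‖complexOp M - complexOp M'‖ :=
  norm_circleIntegral_resolvent_sub_le hr h h'

theorem contDiffAt_complexOp_param {k : ℕ} {lamα : State m → ℝ}
    {D : Set (State m × EuclideanSpace ℝ (Fin k))} {W : State m → EuclideanSpace ℝ (Fin k) → State m}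
    (hA : IsAveragedMatrix f Ω A) (hW : IsCharacteristicParam f Ω lamα D W) (hΩ : IsOpen Ω)
    {V : State m} (hV : V ∈ Ω) :
    ContDiffAt ℝ ∞ (fun x : (State m × State m) × EuclideanSpace ℝ (Fin k) =>
      complexOp (A (W x.1.1 x.2) x.1.2)) ((V, V), 0) := by
  refine contDiffAt_complexOp fun i j => ?_
  have h1 : ContDiffAt ℝ ∞ (fun q : State m × State m => A q.1 q.2 i j) (W V 0, V) := by
    rw [hW.map_zero V hV]
    exact (hA.smooth i j).contDiffAt ((hΩ.prod hΩ).mem_nhds ⟨hV, hV⟩)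
  have h2 : ContDiffAt ℝ ∞ (fun x : (State m × State m) × EuclideanSpace ℝ (Fin k) =>
      W x.1.1 x.2) ((V, V), 0) :=
    ContDiffAt.comp (g := fun q : State m × EuclideanSpace ℝ (Fin k) => W q.1 q.2)
      (f := fun x : (State m × State m) × EuclideanSpace ℝ (Fin k) => (x.1.1, x.2))
      ((V, V), 0) (hW.contDiffAt hV) (by fun_prop)
  exact ContDiffAt.comp (g := fun q : State m × State m => A q.1 q.2 i j)
    (f := fun x : (State m × State m) × EuclideanSpace ℝ (Fin k) => (W x.1.1 x.2, x.1.2))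
    ((V, V), 0) h1 (h2.prodMk (by fun_prop))

end Assembly
end SteadyFlow

/-! ### Existence and uniqueness of the parameter -/

theorem lemma3 {m n : ℕ} (f : SteadyFlow.State m → SteadyFlow.State m)
    (Vbar : SteadyFlow.State m) (ε₀ : ℝ) (hε₀ : 0 < ε₀)
    (lam : Fin n → SteadyFlow.State m → ℝ) (p : Fin n → ℕ)
    (hf : SteadyFlow.IsHyperbolic f (Metric.ball Vbar ε₀) lam p)
    (A : SteadyFlow.State m → SteadyFlow.State m → Matrix (Fin m) (Fin m) ℝ)
    (hA : SteadyFlow.IsAveragedMatrix f (Metric.ball Vbar ε₀) A)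
    (α : Fin n)
    (D : Set (SteadyFlow.State m × EuclideanSpace ℝ (Fin (p α))))
    (W : SteadyFlow.State m → EuclideanSpace ℝ (Fin (p α)) → SteadyFlow.State m)
    (hW : SteadyFlow.IsCharacteristicParam f (Metric.ball Vbar ε₀) (lam α) D W)
    (r : ℝ) (hr : 0 < r)
    (hgap : ∀ β γ : Fin n, β ≠ γ → 2 * r < |lam β Vbar - lam γ Vbar|) :
    ∃ δ₀ : ℝ, 0 < δ₀ ∧ ∀ δ : ℝ, 0 < δ → δ ≤ δ₀ →
      ∃ ε : ℝ, 0 < ε ∧ ε < ε₀ ∧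
        ∀ Vm ∈ Metric.closedBall Vbar ε, ∀ V ∈ Metric.closedBall Vbar ε,
          (∀ s ∈ Metric.ball (0 : EuclideanSpace ℝ (Fin (p α))) δ,
            (Vm, s) ∈ D ∧
            ∀ z ∈ spectrum ℂ (SteadyFlow.complexOp (A (W Vm s) V)),
              ∃ β : Fin n, ‖z - (lam β Vbar : ℂ)‖ < r) ∧
          ∃! s : EuclideanSpace ℝ (Fin (p α)),
            s ∈ Metric.ball (0 : EuclideanSpace ℝ (Fin (p α))) δ ∧
            SteadyFlow.totalProj (lam α Vbar) r (A (W Vm s) V)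
              (SteadyFlow.complexVec (V - W Vm s)) = 0 := by
  open SteadyFlow Filter Topology in
  set Ω := Metric.ball Vbar ε₀ with hΩ
  have hVΩ : Vbar ∈ Ω := Metric.mem_ball_self hε₀
  set x₀ : (State m × State m) × EuclideanSpace ℝ (Fin (p α)) := ((Vbar, Vbar), 0) with hx₀
  obtain ⟨C, hC, hres⟩ := exists_resolvent_bound hf hA hVΩ hr
  have hW0 : W Vbar 0 = Vbar := hW.map_zero Vbar hVΩ
  have hsm := contDiffAt_complexOp_param hA hW Metric.isOpen_ball hVΩ
  have hevD : ∀ᶠ x in 𝓝 x₀, (x.1.1, x.2) ∈ D :=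
    (by fun_prop : Continuous fun x : (State m × State m) × EuclideanSpace ℝ (Fin (p α)) =>
      (x.1.1, x.2)).continuousAt.eventually (hW.isOpen.mem_nhds (hW.zero_mem Vbar hVΩ))
  have hevΩ : ∀ᶠ x in 𝓝 x₀, x.1.2 ∈ Ω :=
    (by fun_prop : Continuous fun x : (State m × State m) × EuclideanSpace ℝ (Fin (p α)) =>
      x.1.2).continuousAt.eventually (Metric.isOpen_ball.mem_nhds hVΩ)
  have hevR : ∀ᶠ x in 𝓝 x₀, ∀ z : ℂ, (∀ β, r ≤ ‖z - lam β Vbar‖) →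
      z ∈ resolventSet ℂ (complexOp (A (W x.1.1 x.2) x.1.2)) ∧
        ‖resolvent (complexOp (A (W x.1.1 x.2) x.1.2)) z‖ ≤ 2 * C := by
    have := hsm.continuousAt.eventually (Metric.closedBall_mem_nhds _
      (by positivity : 0 < (2 * C)⁻¹))
    filter_upwards [this] with x hx
    replace hx : dist _ _ ≤ _ := hx
    rw [hW0, dist_eq_norm] at hx
    exact hres _ hx
  have hevQ : ∀ᶠ x in 𝓝 x₀, ∃ Q : Matrix (Fin m) (Fin m) ℝ, IsIdempotentElem Q ∧
      totalProj (lam α Vbar) r (A (W x.1.1 x.2) x.1.2) = complexOp Q := by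
    filter_upwards [hevD, hevΩ, hevR] with x hxD hxΩ hxR
    obtain ⟨T, d, hT, h⟩ := hA.diagonalizable _ (hW.map_mem _ _ hxD) _ hxΩ
    exact exists_totalProj_eq_complexOp hT h _ hr fun z hz =>
      (hxR z (le_norm_sub_of_mem_sphere hgap hz)).1
  have hbase := reOp_totalProj_base hf hA hVΩ hr hgap fun z hz =>
    (hres _ (by simpa using hC.le) z (le_norm_sub_of_mem_sphere (α := α) hgap hz)).1
  obtain ⟨v', hv', hv's⟩ := hW.exists_hasStrictFDerivAt hVΩ
  have hrange := hW.range_fderiv hVΩ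
  obtain ⟨π, hπ⟩ := LinearMap.exists_leftInverse_of_injective _
    (hW.injective_fderiv hVΩ (hf.finrank_eq Vbar hVΩ α))
  have hQ0 : reOp (totalProj (lam α Vbar) r (A (W x₀.1.1 x₀.2) x₀.1.2)) =
      reOp (totalProj (lam α Vbar) r (A Vbar Vbar)) := by simp [hx₀, hW0]
  have hlip : (fun q : ((State m × State m) × EuclideanSpace ℝ (Fin (p α))) ×
      ((State m × State m) × EuclideanSpace ℝ (Fin (p α))) =>
      reOp (totalProj (lam α Vbar) r (A (W q.1.1.1 q.1.2) q.1.1.2)) -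
        reOp (totalProj (lam α Vbar) r (A (W q.2.1.1 q.2.2) q.2.1.2)))
      =O[𝓝 (x₀, x₀)] fun q => q.1 - q.2 := by
    have h1 := (hsm.hasStrictFDerivAt (by simp)).isBigO_sub
    refine Asymptotics.IsBigO.trans (Asymptotics.IsBigO.of_bound
      (‖reVecL m‖ * ‖complexVecL m‖ * (r * ((2 * C) * (2 * C)))) ?_) h1
    rw [nhds_prod_eq]
    filter_upwards [hevR.prod_mk hevR] with q hq
    obtain ⟨hq1, hq2⟩ := hq
    have h2 := norm_totalProj_sub_le (c := lam α Vbar) hr.le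
      (fun z hz => hq1 z (le_norm_sub_of_mem_sphere hgap hz))
      (fun z hz => hq2 z (le_norm_sub_of_mem_sphere hgap hz))
    refine (norm_reOp_sub_le _ _).trans ?_
    rw [mul_assoc (‖reVecL m‖ * ‖complexVecL m‖)]
    exact mul_le_mul_of_nonneg_left h2 (by positivity)
  obtain ⟨φ, hφ, hiff⟩ := exists_implicitFunction_of_projection
    (Q := fun x : (State m × State m) × EuclideanSpace ℝ (Fin (p α)) =>
      reOp (totalProj (lam α Vbar) r (A (W x.1.1 x.2) x.1.2)))
    (L := fderiv ℝ (W Vbar) 0) (π := LinearMap.toContinuousLinearMap π)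
    (fun s => DFunLike.congr_fun hπ s) hv' (by simp [hW0]) hv's
    hlip
    (by
      filter_upwards [hevQ] with x hx
      obtain ⟨Q, hQ, hQe⟩ := hx
      rw [hQe, reOp_complexOp]
      exact hQ.map _)
    (fun w => by
      have h := hbase.1 w
      rw [← hrange, ← hQ0] at h
      obtain ⟨s, hs⟩ := h
      exact ⟨s, hs.symm⟩)
    (fun s => by
      refine (DFunLike.congr_fun hQ0 _).trans (hbase.2 _ ?_)
      rw [← hrange]
      exact ⟨s, rfl⟩)
  obtain ⟨η, hη, hall⟩ := Metric.eventually_nhds_iff.1 (hevD.and (hevR.and (hevQ.and hiff)))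
  -- δ₀ is the radius of a ball about `x₀` on which solutions are exactly the graph of `φ`; this
  -- gives uniqueness for every smaller δ. Shrinking ε then puts the values of `φ` in the δ-ball,
  -- which gives existence.
  refine ⟨η, hη, fun δ hδ hδη => ?_⟩
  obtain ⟨ε₁, hε₁, hφε⟩ := Metric.eventually_nhds_iff.1
    (hφ.eventually (Metric.ball_mem_nhds (0 : EuclideanSpace ℝ (Fin (p α))) hδ))
  have hεpos : 0 < min ε₀ (min η ε₁) := by positivity
  have hε₀' : min ε₀ (min η ε₁) ≤ ε₀ := min_le_left _ _
  have hη' : min ε₀ (min η ε₁) ≤ η := (min_le_right _ _).trans (min_le_left _ _)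
  have hε₁' : min ε₀ (min η ε₁) ≤ ε₁ := (min_le_right _ _).trans (min_le_right _ _)
  -- Halving turns the closed ε-ball into a subset of the open balls of radii `ε₀`, `η` and `ε₁`.
  refine ⟨min ε₀ (min η ε₁) / 2, by positivity, by linarith, fun Vm hVm V hV => ?_⟩
  rw [Metric.mem_closedBall] at hVm hV
  have key : ∀ s ∈ Metric.ball (0 : EuclideanSpace ℝ (Fin (p α))) δ,
      dist ((Vm, V), s) x₀ < η := fun s hs => by
    rw [Metric.mem_ball] at hs
    rw [hx₀, Prod.dist_eq, Prod.dist_eq]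
    exact max_lt (max_lt (by linarith) (by linarith)) (by linarith)
  have hzero : ∀ s ∈ Metric.ball (0 : EuclideanSpace ℝ (Fin (p α))) δ,
      (totalProj (lam α Vbar) r (A (W Vm s) V) (complexVec (V - W Vm s)) = 0 ↔
        φ (Vm, V) = s) := fun s hs => by
    -- Since the total projection is the complexification of a real `Q`, the complex equation is
    -- equivalent to its real part.
    obtain ⟨-, -, ⟨Q, hQ, hQe⟩, h⟩ := hall (key s hs)
    rw [← h]
    simp only at hQe ⊢
    rw [hQe, reOp_complexOp, complexOp_complexVec, complexVec_eq_zero]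
  have hφmem : φ (Vm, V) ∈ Metric.ball (0 : EuclideanSpace ℝ (Fin (p α))) δ := by
    refine hφε ?_
    rw [Prod.dist_eq]
    exact max_lt (by linarith) (by linarith)
  refine ⟨fun s hs => ⟨(hall (key s hs)).1, fun z hz => ?_⟩,
    φ (Vm, V), ⟨hφmem, (hzero _ hφmem).2 rfl⟩, fun s hs => ((hzero s hs.1).1 hs.2).symm⟩
  -- A point outside all the open discs lies in the resolvent set.
  by_contra! hne
  exact hz ((hall (key s hs)).2.1 z hne).1
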